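/- Let $\mathcal Z=\{\dots,\tfrac13,\tfrac12,1,2,3,\dots\}$ and let $\mathcal N$ be the set of non-decreasing functions $\mathcal Z\to[0,\infty]$. For $t>0$ let $t_-$ and $t_+$ be the largest, respectively smallest, element of $\mathcal Z$ with $t_-\le t\le t_+$. Put $$\mathcal M_{\rm coarse}=\{(\kappa,\omega)\in\mathcal N^2 : \omega(r)<\infty\ \forall r\in\mathcal Z,\ \lim_n\kappa(n)=\infty\},$$ $$\mathcal M_{\rm uniform}=\{(\kappa,\omega)\in\mathcal N^2 : \kappa(r)>0\ \forall r\in\mathcal Z,\ \lim_n\omega(\tfrac1n)=0\},$$ $$\mathcal M_{\rm Lipschitz}=\{(\kappa,\omega)\in\mathcal N^2 : \exists\,0<c<C<\infty\ \forall r\in\mathcal Z\ \ \kappa(r)\ge cr,\ \omega(r)\le Cr\}.$$ A map $\phi:Y\to E$ of metric spaces is a coarse, uniform, or bi-Lipschitz embedding if the pair $(\kappa_\phi,\omega_\phi)$, where $\kappa_\phi(r)=\inf\{d(\phi(x),\phi(y)): d(x,y)\ge r\}$ (with $\inf\emptyset=\infty$) and $\omega_\phi(r)=\sup\{d(\phi(x),\phi(y)):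 d(x,y)\le r\}$, belongs to $\mathcal M_{\rm coarse}$, $\mathcal M_{\rm uniform}$, or $\mathcal M_{\rm Lipschitz}$, respectively. Let $(e_n)$ be a Schauder basis of a real Banach space $X$ that is subsymmetric in the sense that it is equivalent to each of its subsequences: for all $n_1<n_2<\cdots$ and all real scalars $(a_k)$, the series $\sum a_ke_k$ converges if and only if $\sum a_ke_{n_k}$ converges (unconditionality is not required). Let $R$ be $\mathbb Z$ or $\mathbb Q$. For $A\subseteq\{e_1,e_2,\dots\}$ let $R[A]\subseteq X$ be the $R$-submodule spanned by $A$; write $R[e_1,e_2,\dots]$ when $A=\{e_1,e_2,\dots\}$. These carry the metric induced by the norm of $X$. Let $E$ be a separable complete metric space. Let $\Theta(R,(e_n),E)$ be the set of quadruples $(\kappa,\omega,A,\phi)$ with $\kappa,\omega\in\mathcal N$, $A\subseteq\{e_1,e_2,\dots\}$ finite and $\phi:R[e_1,e_2,\dots]\to E$ a map such that $$\kappa(\|x-y\|_-)\le d(\phi(x),\phi(y))\le\omega(\|x-y\|_+)\quad\text{for all distinct }x,y\in R[A].$$ Let $\mathcal{C}oa(R,(e_n),E)$, $\mathcal{U}ni(R,(e_n),E)$,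 $\mathcal{L}ip(R,(e_n),E)$ be the sets of those quadruples in $\Theta(R,(e_n),E)$ for which $(\kappa,\omega)$ lies in $\mathcal M_{\rm coarse}$, $\mathcal M_{\rm uniform}$, $\mathcal M_{\rm Lipschitz}$, respectively. Let $(\kappa,\omega,A,\phi)<(\kappa',\omega',A',\phi')$ mean that $(\kappa,\omega)=(\kappa',\omega')$, that $A'=\{e_{n_1},\dots,e_{n_k}\}$ and $A=\{e_{n_1},\dots,e_{n_k},e_{n_{k+1}}\}$ for some $n_1<\dots<n_k<n_{k+1}$ (with $k\ge 0$), and that $\phi$ and $\phi'$ agree on $R[A']$. The rank of a well-founded relation $\prec$ on a set $S$ is the ordinal $\sup\{\rho(x)+1:x\in S\}$, where $\rho(x)=\sup\{\rho(y)+1:y\prec x\}$. **Theorem.** Either $R[e_1,e_2,\dots]$ coarsely embeds into $E$, or the relation $<$ is well-founded on $\mathcal{C}oa(R,(e_n),E)$ and its rank is a countable ordinal. Likewise, either $R[e_1,e_2,\dots]$ uniformly embeds into $E$, or $<$ is well-founded on $\mathcal{U}ni(R,(e_n),E)$ with countable rank; and either $R[e_1,e_2,\dots]$ bi-Lipschitz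 embeds into $E$, or $<$ is well-founded on $\mathcal{L}ip(R,(e_n),E)$ with countable rank. -/

import Mathlib

open Filter Topology
open scoped ENNReal

noncomputable section

namespace EmbRank

universe u

/-- The set `𝒵 = {…, 1/3, 1/2, 1, 2, 3, …}` of scales. -/
def scaleSet : Set ℝ := {r | ∃ n : ℕ, 0 < n ∧ (r = (n : ℝ) ∨ r = 1 / (n : ℝ))}

/-- The scales, with the order inherited from `ℝ`. -/
abbrev Scale : Type := ↥scaleSet

/-- The scale `n + 1`. -/
def natScale (n : ℕ) : Scale := ⟨((n + 1 : ℕ) : ℝ), n + 1, n.succ_pos, Or.inl rfl⟩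

/-- The scale `1 / (n + 1)`. -/
def invScale (n : ℕ) : Scale := ⟨1 / ((n + 1 : ℕ) : ℝ), n + 1, n.succ_pos, Or.inr rfl⟩

/-- The set `𝒩` of non-decreasing functions from `𝒵` to `[0, ∞]`. -/
abbrev Modulus : Type := Scale →o ℝ≥0∞

theorem exists_scaleBelow {t : ℝ} (ht : 0 < t) :
    ∃ r : Scale, IsGreatest {s : Scale | (s : ℝ) ≤ t} r := by
  rcases le_or_gt 1 t with h | h
  · have hpos : 0 < ⌊t⌋₊ := Nat.floor_pos.2 h
    refine ⟨⟨(⌊t⌋₊ : ℝ), _, hpos, Or.inl rfl⟩, Nat.floor_le ht.le, ?_⟩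
    rintro ⟨s, m, hm, rfl | rfl⟩ hs
    · exact Subtype.mk_le_mk.2 (Nat.cast_le.2 (Nat.le_floor hs))
    · refine Subtype.mk_le_mk.2 (le_trans ?_ (Nat.one_le_cast.2 hpos))
      exact (div_le_one (Nat.cast_pos.2 hm)).2 (Nat.one_le_cast.2 hm)
  · have hpos : 0 < ⌈1 / t⌉₊ := Nat.ceil_pos.2 (by positivity)
    refine ⟨⟨1 / (⌈1 / t⌉₊ : ℝ), _, hpos, Or.inr rfl⟩, ?_, ?_⟩
    · exact (one_div_le (Nat.cast_pos.2 hpos) ht).2 (Nat.le_ceil _)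
    · rintro ⟨s, m, hm, rfl | rfl⟩ hs
      · have h1 : (1 : ℝ) ≤ m := Nat.one_le_cast.2 hm
        exact absurd (le_trans h1 hs) (not_le.2 h)
      · refine Subtype.mk_le_mk.2 (one_div_le_one_div_of_le (Nat.cast_pos.2 hpos) ?_)
        exact Nat.cast_le.2 (Nat.ceil_le.2 ((one_div_le (Nat.cast_pos.2 hm) ht).1 hs))

theorem exists_scaleAbove {t : ℝ} (ht : 0 < t) :
    ∃ r : Scale, IsLeast {s : Scale | t ≤ (s : ℝ)} r := by
  rcases lt_or_ge 1 t with h | h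
  · have hpos : 0 < ⌈t⌉₊ := Nat.ceil_pos.2 ht
    refine ⟨⟨(⌈t⌉₊ : ℝ), _, hpos, Or.inl rfl⟩, Nat.le_ceil t, ?_⟩
    rintro ⟨s, m, hm, rfl | rfl⟩ hs
    · exact Subtype.mk_le_mk.2 (Nat.cast_le.2 (Nat.ceil_le.2 hs))
    · have h1 : 1 / (m : ℝ) ≤ 1 := (div_le_one (Nat.cast_pos.2 hm)).2 (Nat.one_le_cast.2 hm)
      exact absurd (le_trans hs h1) (not_le.2 h)
  · have h1t : 1 ≤ 1 / t := (one_le_div ht).2 h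
    have hpos : 0 < ⌊1 / t⌋₊ := Nat.floor_pos.2 h1t
    have hp1 : (1 : ℝ) ≤ (⌊1 / t⌋₊ : ℝ) := Nat.one_le_cast.2 hpos
    refine ⟨⟨1 / (⌊1 / t⌋₊ : ℝ), _, hpos, Or.inr rfl⟩, ?_, ?_⟩
    · exact (le_one_div ht (Nat.cast_pos.2 hpos)).2 (Nat.floor_le (by positivity))
    · rintro ⟨s, m, hm, rfl | rfl⟩ hs
      · refine Subtype.mk_le_mk.2 (le_trans ?_ (Nat.one_le_cast.2 hm))
        exact (div_le_one (Nat.cast_pos.2 hpos)).2 hp1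
      · refine Subtype.mk_le_mk.2 (one_div_le_one_div_of_le (Nat.cast_pos.2 hm) ?_)
        exact Nat.cast_le.2 (Nat.le_floor ((le_one_div ht (Nat.cast_pos.2 hm)).1 hs))

/-- `t₋`, the largest scale that is at most `t`. -/
def scaleBelow (t : ℝ) (ht : 0 < t) : Scale := (exists_scaleBelow ht).choose

/-- `t₊`, the smallest scale that is at least `t`. -/
def scaleAbove (t : ℝ) (ht : 0 < t) : Scale := (exists_scaleAbove ht).choose

theorem scaleBelow_spec (t : ℝ) (ht : 0 < t) :
    IsGreatest {s : Scale | (s : ℝ) ≤ t} (scaleBelow t ht) := (exists_scaleBelow ht).choose_spec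

theorem scaleAbove_spec (t : ℝ) (ht : 0 < t) :
    IsLeast {s : Scale | t ≤ (s : ℝ)} (scaleAbove t ht) := (exists_scaleAbove ht).choose_spec

/-- `𝓜_coarse`: `ω` is finite-valued and `κ(n) → ∞`. -/
def coarseModuli : Set (Modulus × Modulus) :=
  {p | (∀ r, p.2 r < ⊤) ∧ Tendsto (fun n : ℕ => p.1 (natScale n)) atTop (𝓝 ⊤)}

/-- `𝓜_uniform`: `κ` is strictly positive and `ω(1/n) → 0`. -/
def uniformModuli : Set (Modulus × Modulus) :=
  {p | (∀ r, 0 < p.1 r) ∧ Tendsto (fun n : ℕ => p.2 (invScale n)) atTop (𝓝 0)}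

/-- `𝓜_Lipschitz`: `κ(r) ≥ c r` and `ω(r) ≤ C r` for some `0 < c < C < ∞`. -/
def lipschitzModuli : Set (Modulus × Modulus) :=
  {p | ∃ c C : ℝ, 0 < c ∧ c < C ∧
    ∀ r : Scale, ENNReal.ofReal (c * r) ≤ p.1 r ∧ p.2 r ≤ ENNReal.ofReal (C * r)}

section Moduli

variable {Y E : Type*} [MetricSpace Y] [MetricSpace E]

/-- `κ_φ(r) = inf {d(φ x, φ y) | d(x, y) ≥ r}`, where `inf ∅ = ∞`. -/
def compression (φ : Y → E) : Modulus where
  toFun r := ⨅ (x : Y) (y : Y) (_ : (r : ℝ) ≤ dist x y), edist (φ x) (φ y)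
  monotone' _ _ hrs := iInf_mono fun _ => iInf_mono fun _ =>
    iInf_mono' fun h => ⟨le_trans (Subtype.coe_le_coe.2 hrs) h, le_rfl⟩

/-- `ω_φ(r) = sup {d(φ x, φ y) | d(x, y) ≤ r}`. -/
def expansion (φ : Y → E) : Modulus where
  toFun r := ⨆ (x : Y) (y : Y) (_ : dist x y ≤ (r : ℝ)), edist (φ x) (φ y)
  monotone' _ _ hrs := iSup_mono fun _ => iSup_mono fun _ =>
    iSup_mono' fun h => ⟨le_trans h (Subtype.coe_le_coe.2 hrs), le_rfl⟩

end Moduli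

/-- `Y` embeds into `E` by a map whose pair of moduli belongs to `M`. -/
def EmbedsInto (M : Set (Modulus × Modulus)) (Y E : Type*) [MetricSpace Y] [MetricSpace E] :
    Prop :=
  ∃ φ : Y → E, (compression φ, expansion φ) ∈ M

/-- `Y` coarsely embeds into `E`. -/
def CoarselyEmbeds (Y E : Type*) [MetricSpace Y] [MetricSpace E] : Prop :=
  EmbedsInto coarseModuli Y E

/-- `Y` uniformly embeds into `E`. -/
def UniformlyEmbeds (Y E : Type*) [MetricSpace Y] [MetricSpace E] : Prop :=
  EmbedsInto uniformModuli Y E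

/-- `Y` bi-Lipschitz embeds into `E`. -/
def BiLipschitzEmbeds (Y E : Type*) [MetricSpace Y] [MetricSpace E] : Prop :=
  EmbedsInto lipschitzModuli Y E

/-- The rank `sup {ρ(a) + 1 | a ∈ α}` of a well-founded relation, where
`ρ(a) = sup {ρ(b) + 1 | r b a}`. -/
def wfRank {α : Type u} (r : α → α → Prop) (h : WellFounded r) : Ordinal.{u} :=
  ⨆ a : α, Order.succ (h.apply a).rank

/-- The relation `r` has a rank (that is, it is well-founded), and this rank is a countable
ordinal. -/
def HasCountableRank {α : Type u} (r : α → α → Prop) : Prop :=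
  ∃ h : WellFounded r, (wfRank r h).card ≤ Cardinal.aleph0

section Basis

variable {X : Type*} [NormedAddCommGroup X] [NormedSpace ℝ X]

/-- Two sequences of vectors are equivalent: for all scalars `a₀, a₁, …`, the series `∑ aₖ uₖ`
converges if and only if `∑ aₖ vₖ` does. -/
def EquivalentSeq (u v : ℕ → X) : Prop :=
  ∀ a : ℕ → ℝ,
    (∃ x, Tendsto (fun N => ∑ k ∈ Finset.range N, a k • u k) atTop (𝓝 x)) ↔
      ∃ y, Tendsto (fun N => ∑ k ∈ Finset.range N, a k • v k) atTop (𝓝 y)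

/-- A sequence is subsymmetric if it is equivalent to each of its subsequences. (Some authors
require unconditionality in addition; it is not needed here.) -/
def IsSubsymmetric (e : ℕ → X) : Prop :=
  ∀ n : ℕ → ℕ, StrictMono n → EquivalentSeq e (fun k => e (n k))

/-- For a subring `R` of `ℝ`, the `R`-submodule `R[{eᵢ | i ∈ A}]` of `X`. -/
abbrev spanOn (R : Subring ℝ) (e : ℕ → X) (A : Set ℕ) : Submodule R X :=
  Submodule.span R (e '' A)

/-- `R[e₀, e₁, …]`, with the metric of `X`. -/
abbrev FullSpan (R : Subring ℝ) (e : ℕ → X) : Type _ := ↥(spanOn R e Set.univ)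

/-- `A ≺⋆ B`: `A` arises from the finite set `B` by adding one element larger than all elements
of `B`. A set `A` of indices stands for the set `{eᵢ | i ∈ A}`. -/
def EndExt (A B : Finset ℕ) : Prop := ∃ n : ℕ, (∀ m ∈ B, m < n) ∧ A = insert n B

/-- The type of all quadruples `(κ, ω, A, φ)`. -/
abbrev Quad (R : Subring ℝ) (e : ℕ → X) (E : Type*) : Type _ :=
  Modulus × Modulus × Finset ℕ × (FullSpan R e → E)

/-- `Θ(R, (eₙ), E)`: the quadruples `(κ, ω, A, φ)` with
`κ(‖x - y‖₋) ≤ d(φ x, φ y) ≤ ω(‖x - y‖₊)` for all distinct `x, y ∈ R[A]`. -/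
def Theta (R : Subring ℝ) (e : ℕ → X) (E : Type*) [MetricSpace E] : Set (Quad R e E) :=
  {q | ∀ x y : FullSpan R e, (x : X) ∈ spanOn R e q.2.2.1 → (y : X) ∈ spanOn R e q.2.2.1 →
    ∀ hxy : x ≠ y,
      q.1 (scaleBelow (dist x y) (dist_pos.2 hxy)) ≤ edist (q.2.2.2 x) (q.2.2.2 y) ∧
      edist (q.2.2.2 x) (q.2.2.2 y) ≤ q.2.1 (scaleAbove (dist x y) (dist_pos.2 hxy))}

/-- The quadruples `(κ, ω, A, φ)` in `Θ(R, (eₙ), E)` with `(κ, ω) ∈ M`. -/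
def ThetaIn (M : Set (Modulus × Modulus)) (R : Subring ℝ) (e : ℕ → X) (E : Type*)
    [MetricSpace E] : Set (Quad R e E) :=
  {q | q ∈ Theta R e E ∧ (q.1, q.2.1) ∈ M}

/-- `Coa(R, (eₙ), E)`. -/
def Coa (R : Subring ℝ) (e : ℕ → X) (E : Type*) [MetricSpace E] : Set (Quad R e E) :=
  ThetaIn coarseModuli R e E

/-- `Uni(R, (eₙ), E)`. -/
def Uni (R : Subring ℝ) (e : ℕ → X) (E : Type*) [MetricSpace E] : Set (Quad R e E) :=
  ThetaIn uniformModuli R e E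

/-- `Lip(R, (eₙ), E)`. -/
def Lip (R : Subring ℝ) (e : ℕ → X) (E : Type*) [MetricSpace E] : Set (Quad R e E) :=
  ThetaIn lipschitzModuli R e E

/-- `(κ, ω, A, φ) < (κ', ω', A', φ')`: the moduli agree, `A ≺⋆ A'`, and `φ`, `φ'` agree on
`R[A']`. -/
def QuadLT (R : Subring ℝ) (e : ℕ → X) (E : Type*) (q q' : Quad R e E) : Prop :=
  (q.1 = q'.1 ∧ q.2.1 = q'.2.1) ∧ EndExt q.2.2.1 q'.2.2.1 ∧
    ∀ x : FullSpan R e, (x : X) ∈ spanOn R e q'.2.2.1 → q.2.2.2 x = q'.2.2.2 x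

/-- The relation `<` restricted to a set of quadruples. -/
def ltOn (R : Subring ℝ) (e : ℕ → X) (E : Type*) (S : Set (Quad R e E)) (q q' : S) : Prop :=
  QuadLT R e E q q'

end Basis

end EmbRank

end

open EmbRank

/-! The quadruples form a possibly uncountable set, so the order `<` is mapped to end extension of
codes in a countable set. A code records `A` and, truncated at the cardinality of `A`, integer
parameters describing `(κ, ω)` and approximations to the values of `φ` on a countable enumeration of
the span. If end extension is well-founded on the codes that occur, its rank is countable, and
`hasCountableRank_of_map` pulls this back.

Otherwise there is an infinite descending chain of codes, each realised by a quadruple. These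
quadruples need not extend one another, but their parameters and approximations stabilise, so by
completeness of `E` the maps converge pointwise on the span of an infinite subsequence of the basis.
The moduli are described by closed conditions (`IsControl`), which survive the limit. Subsymmetry
(`exists_shift`) identifies the full span with the span of that subsequence up to bi-Lipschitz
equivalence, so the full span embeds (`embedsInto_of_codeLT_chain`). -/

namespace EmbRank

universe v

/-! ### Countability of ranks. -/

section Rank

open Ordinal

/-- A relation that maps to a well-founded relation on a countable type has countable rank. -/
theorem hasCountableRank_of_map {α β : Type v} [Countable β] {r : α → α → Prop}
    {s : β → β → Prop} (hs : WellFounded s) (f : α → β) (hf : ∀ a b, r a b → s (f a) (f b)) :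
    HasCountableRank r := by
  have hr : WellFounded r := Subrelation.wf (fun {a b} h => hf a b h) (InvImage.wf f hs)
  have hsucc : ∀ o : Ordinal.{v}, o < ω₁ → Order.succ o < ω₁ := fun o h =>
    (Cardinal.isSuccLimit_omega 1).succ_lt h
  have hcount : ∀ b, (hs.apply b).rank < ω₁ := by
    intro b
    induction b using hs.induction with
    | _ b ih =>
      rw [Acc.rank_eq]
      -- A supremum of countably many countable ordinals is countable.
      exact Ordinal.iSup_lt_omega_one fun c => hsucc _ (ih c.1 c.2)
  have hle : ∀ a, (hr.apply a).rank ≤ (hs.apply (f a)).rank := by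
    intro a
    induction a using hr.induction with
    | _ a ih =>
      rw [(hr.apply a).rank_eq]
      exact Ordinal.iSup_le fun c => Order.succ_le_of_lt
        ((ih c.1 c.2).trans_lt (Acc.rank_lt_of_rel _ (hf _ _ c.2)))
  have hlt : wfRank r hr < ω₁ :=
    (Ordinal.iSup_le fun a => (Order.succ_le_succ (hle a)).trans
      (Ordinal.le_iSup (fun b => Order.succ (hs.apply b).rank) (f a))).trans_lt
      (Ordinal.iSup_lt_omega_one fun b => hsucc _ (hcount b))
  refine ⟨hr, ?_⟩
  rw [Cardinal.card_le_iff, Cardinal.succ_aleph0]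
  simpa using hlt

end Rank

/-! ### Subsymmetric bases and shift operators. -/

section Basis

variable {X : Type*} [NormedAddCommGroup X] [NormedSpace ℝ X]

/-- A pointwise convergent series `∑ fₖ(y) vₖ` of rank one operators on a Banach space defines a
continuous linear operator. -/
theorem exists_clm_of_tendsto_sum {Y : Type*} [NormedAddCommGroup Y] [NormedSpace ℝ Y]
    [CompleteSpace Y] (f : ℕ → Y →L[ℝ] ℝ) (v : ℕ → X)
    (h : ∀ y, ∃ x, Tendsto (fun N => ∑ k ∈ Finset.range N, f k y • v k) atTop (𝓝 x)) :
    ∃ T : Y →L[ℝ] X,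
      ∀ y, Tendsto (fun N => ∑ k ∈ Finset.range N, f k y • v k) atTop (𝓝 (T y)) := by
  choose t ht using h
  have ht' : Tendsto (fun N y => (∑ k ∈ Finset.range N, (f k).smulRight (v k) : Y →L[ℝ] X) y)
      atTop (𝓝 t) := by
    refine tendsto_pi_nhds.2 fun y => ?_
    simpa [_root_.sum_apply] using ht y
  -- Banach–Steinhaus: a pointwise limit of continuous operators on a Banach space is continuous.
  exact ⟨continuousLinearMapOfTendsto _ ht', ht⟩

theorem sum_range_eq_sum_comp {M : Type*} [AddCommMonoid M] {m : ℕ → ℕ} (hm : StrictMono m)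
    (g : ℕ → M) (hg : ∀ i, i ∉ Set.range m → g i = 0) (N : ℕ) :
    ∑ i ∈ Finset.range (m N), g i = ∑ k ∈ Finset.range N, g (m k) := by
  rw [← Finset.sum_image (s := Finset.range N) (g := m) (fun a _ b _ h => hm.injective h)]
  symm
  refine Finset.sum_subset ?_ ?_
  · intro i hi
    obtain ⟨k, hk, rfl⟩ := Finset.mem_image.1 hi
    exact Finset.mem_range.2 (hm (Finset.mem_range.1 hk))
  · intro i hi hi'
    refine hg i ?_
    rintro ⟨k, rfl⟩
    exact hi' (Finset.mem_image_of_mem _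
      (Finset.mem_range.2 (hm.lt_iff_lt.1 (Finset.mem_range.1 hi))))

/-- The shift of a subsymmetric basis to one of its subsequences is an isomorphism onto its
range. -/
theorem exists_shift [CompleteSpace X] (e : SchauderBasis ℝ X)
    (he : IsSubsymmetric (fun n => e n)) {m : ℕ → ℕ} (hm : StrictMono m) :
    ∃ T : X →L[ℝ] X, (∀ k, T (e k) = e (m k)) ∧ ∃ L : ℝ, ∀ x, ‖x‖ ≤ L * ‖T x‖ := by
  have hexp : ∀ x, Tendsto (fun N => ∑ k ∈ Finset.range N, e.coord k x • e k) atTop (𝓝 x) := by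
    intro x
    simpa using SchauderBasis.tendsto_proj e x
  obtain ⟨T, hT⟩ := exists_clm_of_tendsto_sum (fun k => e.coord k) (fun k => e (m k))
    fun x => (he m hm (fun k => e.coord k x)).1 ⟨x, hexp x⟩
  have hTcoord : ∀ i x, Tendsto
      (fun N => ∑ k ∈ Finset.range N, e.coord k x * e.coord i (e (m k))) atTop
      (𝓝 (e.coord i (T x))) := by
    intro i x
    simpa [Function.comp_def] using ((e.coord i).continuous.tendsto _).comp (hT x)
  have hcm : ∀ j x, e.coord (m j) (T x) = e.coord j x := by
    intro j x
    refine tendsto_nhds_unique (hTcoord (m j) x) (tendsto_const_nhds.congr' ?_)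
    filter_upwards [eventually_gt_atTop j] with N hN
    simp [e.ortho, Pi.single_apply, hm.injective.eq_iff, hN]
  have hc0 : ∀ i, i ∉ Set.range m → ∀ x, e.coord i (T x) = 0 := by
    intro i hi x
    refine tendsto_nhds_unique (hTcoord i x) (tendsto_const_nhds.congr fun N => ?_)
    refine (Finset.sum_eq_zero fun k _ => ?_).symm
    have hik : i ≠ m k := fun h => hi ⟨k, h.symm⟩
    simp [e.ortho, hik]
  -- `Y`, the closed subspace of vectors supported on the subsequence, contains the range of `T`.
  -- The converse half of the equivalence gives a bounded `S` on `Y` with `S ∘ T = id`, whence the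
  -- lower bound with `L = ‖S‖`.
  let Y : Submodule ℝ X := ⨅ i : {i // i ∉ Set.range m}, (e.coord i.1).ker
  have hY : ∀ y, y ∈ Y ↔ ∀ i, i ∉ Set.range m → e.coord i y = 0 := by
    intro y
    simp [Y, Submodule.mem_iInf]
  have hYc : IsClosed (Y : Set X) := by
    have : (Y : Set X) = ⋂ i : {i // i ∉ Set.range m}, {y | e.coord i.1 y = 0} := by
      ext y
      simp [hY]
    rw [this]
    exact isClosed_iInter fun i => isClosed_eq (e.coord i.1).continuous continuous_const
  have : CompleteSpace Y := hYc.completeSpace_coe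
  obtain ⟨S, hS⟩ := exists_clm_of_tendsto_sum (Y := Y)
    (fun k => (e.coord (m k)).comp Y.subtypeL) (fun k => e k) fun y => by
      refine (he m hm _).2 ⟨y, ?_⟩
      refine ((hexp y).comp hm.tendsto_atTop).congr fun N => ?_
      exact sum_range_eq_sum_comp hm _
        (fun i hi => by rw [(hY y).1 y.2 i hi, zero_smul]) N
  refine ⟨T, fun k => ?_, ‖S‖, fun x => ?_⟩
  · refine tendsto_nhds_unique (hT (e k)) (tendsto_const_nhds.congr' ?_)
    filter_upwards [eventually_gt_atTop k] with N hN
    simp [e.ortho, Pi.single_apply, hN]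
  · have hx : S ⟨T x, (hY _).2 fun i hi => hc0 i hi x⟩ = x := by
      refine tendsto_nhds_unique (hS _) ((hexp x).congr fun N => ?_)
      simp [hcm]
    calc ‖x‖ = ‖S ⟨T x, (hY _).2 fun i hi => hc0 i hi x⟩‖ := by rw [hx]
      _ ≤ ‖S‖ * ‖T x‖ := S.le_opNorm _

end Basis

/-! ### Comparison of `t₋` and `t₊` with `t`. -/

section Scales

theorem Scale.pos (r : Scale) : (0 : ℝ) < r := by
  obtain ⟨s, n, hn, rfl | rfl⟩ := r
  · exact Nat.cast_pos.2 hn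
  · exact one_div_pos.2 (Nat.cast_pos.2 hn)

theorem natScale_coe (n : ℕ) : (natScale n : ℝ) = n + 1 := by
  simp [natScale]

theorem invScale_coe (n : ℕ) : (invScale n : ℝ) = 1 / ((n : ℝ) + 1) := by
  simp [invScale]

theorem le_scaleBelow {r : Scale} {t : ℝ} (ht : 0 < t) (h : (r : ℝ) ≤ t) :
    r ≤ scaleBelow t ht := (scaleBelow_spec t ht).2 h

theorem scaleAbove_le {r : Scale} {t : ℝ} (ht : 0 < t) (h : t ≤ (r : ℝ)) :
    scaleAbove t ht ≤ r := (scaleAbove_spec t ht).2 h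

/-- Consecutive scales differ by a factor of at most 2. -/
theorem exists_scale_half_le {t : ℝ} (ht : 0 < t) : ∃ r : Scale, (r : ℝ) ≤ t ∧ t ≤ 2 * r := by
  rcases le_or_gt 1 t with h | h
  · have hpos : 0 < ⌊t⌋₊ := Nat.floor_pos.2 h
    refine ⟨⟨(⌊t⌋₊ : ℝ), _, hpos, Or.inl rfl⟩, Nat.floor_le ht.le, ?_⟩
    have h1 : (1 : ℝ) ≤ (⌊t⌋₊ : ℝ) := Nat.one_le_cast.2 hpos
    have h2 := Nat.lt_floor_add_one t
    change t ≤ 2 * (⌊t⌋₊ : ℝ)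
    linarith
  · have hpos : 0 < ⌈1 / t⌉₊ := Nat.ceil_pos.2 (by positivity)
    have hpos' : (0 : ℝ) < ⌈1 / t⌉₊ := Nat.cast_pos.2 hpos
    refine ⟨⟨1 / (⌈1 / t⌉₊ : ℝ), _, hpos, Or.inr rfl⟩, ?_, ?_⟩
    · exact (one_div_le hpos' ht).2 (Nat.le_ceil _)
    · have h1 : (1 : ℝ) < 1 / t := (one_lt_div ht).2 h
      have h2 : (⌈1 / t⌉₊ : ℝ) ≤ 2 * (1 / t) := by
        linarith [Nat.ceil_lt_add_one (one_div_pos.2 ht).le]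
      change t ≤ 2 * (1 / (⌈1 / t⌉₊ : ℝ))
      rw [mul_one_div, le_div_iff₀ hpos']
      calc t * (⌈1 / t⌉₊ : ℝ) ≤ t * (2 * (1 / t)) := by gcongr
        _ = 2 := by field_simp

theorem le_two_mul_scaleBelow {t : ℝ} (ht : 0 < t) : t ≤ 2 * scaleBelow t ht := by
  obtain ⟨r, hr, hr'⟩ := exists_scale_half_le ht
  have : (r : ℝ) ≤ scaleBelow t ht := le_scaleBelow ht hr
  linarith

theorem scaleAbove_le_two_mul {t : ℝ} (ht : 0 < t) : (scaleAbove t ht : ℝ) ≤ 2 * t := by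
  -- The inversion `t ↦ 1 / t` preserves the set of scales and exchanges lower and upper
  -- approximation.
  obtain ⟨r, hr, hr'⟩ := exists_scale_half_le (one_div_pos.2 ht)
  have hr0 := r.pos
  have hinv : 1 / (r : ℝ) ∈ scaleSet := by
    obtain ⟨s, n, hn, rfl | rfl⟩ := r
    · exact ⟨n, hn, Or.inr rfl⟩
    · exact ⟨n, hn, Or.inl (one_div_one_div _)⟩
  have h1 : (scaleAbove t ht : ℝ) ≤ 1 / (r : ℝ) :=
    scaleAbove_le (r := ⟨_, hinv⟩) ht ((le_one_div ht hr0).2 hr)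
  refine h1.trans ?_
  rw [div_le_iff₀ hr0]
  rw [div_le_iff₀ ht] at hr'
  linarith

theorem exists_ofReal_one_div_lt {ε : ℝ≥0∞} (hε : 0 < ε) :
    ∃ k : ℕ, ENNReal.ofReal (1 / ((k : ℝ) + 1)) < ε := by
  obtain ⟨δ, h0, hδ⟩ := ENNReal.lt_iff_exists_nnreal_btwn.1 hε
  obtain ⟨k, hk⟩ := exists_nat_one_div_lt (NNReal.coe_pos.2 (ENNReal.coe_pos.1 h0))
  refine ⟨k, lt_of_le_of_lt ?_ hδ⟩
  rw [← ENNReal.ofReal_coe_nnreal]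
  exact ENNReal.ofReal_le_ofReal hk.le

end Scales

/-! ### Closed descriptions of the three classes of moduli. -/

section Controls

variable {Y E : Type*} [MetricSpace Y] [MetricSpace E]

theorem le_compression {φ : Y → E} {r : Scale} {t : ℝ}
    (h : ∀ x y, x ≠ y → (r : ℝ) ≤ dist x y → t ≤ dist (φ x) (φ y)) :
    ENNReal.ofReal t ≤ compression φ r := by
  refine le_iInf fun x => le_iInf fun y => le_iInf fun hxy => ?_
  rw [edist_dist]
  exact ENNReal.ofReal_le_ofReal (h x y (dist_pos.1 (r.pos.trans_le hxy)) hxy)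

theorem expansion_le {φ : Y → E} {r : Scale} {t : ℝ}
    (h : ∀ x y, x ≠ y → dist x y ≤ (r : ℝ) → dist (φ x) (φ y) ≤ t) :
    expansion φ r ≤ ENNReal.ofReal t := by
  refine iSup_le fun x => iSup_le fun y => iSup_le fun hxy => ?_
  rcases eq_or_ne x y with rfl | hne
  · simp
  · rw [edist_dist]
    exact ENNReal.ofReal_le_ofReal (h x y hne hxy)

/-- The class `M` of pairs of moduli is described by the closed conditions `t ∈ C k j s` on the
distances `s` in the source and `t` in the target, where for every `k` one parameter `j` has to be
found, and this description is stable under bi-Lipschitz changes of the metric of `Y`. -/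
structure IsControl (M : Set (Modulus × Modulus)) (C : ℕ → ℕ × ℕ → ℝ → Set ℝ)
    (Y E : Type*) [MetricSpace Y] [MetricSpace E] : Prop where
  isClosed (k : ℕ) (j : ℕ × ℕ) (s : ℝ) : IsClosed (C k j s)
  exists_param (p : Modulus × Modulus) (hp : p ∈ M) (k : ℕ) : ∃ j, ∀ (s : ℝ) (hs : 0 < s) (t : ℝ),
    0 ≤ t → p.1 (scaleBelow s hs) ≤ ENNReal.ofReal t →
      ENNReal.ofReal t ≤ p.2 (scaleAbove s hs) → t ∈ C k j s
  mem_of_forall (ψ : Y → E) (d : Y → Y → ℝ) (L : ℝ) (hL : 0 < L)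
    (hd : ∀ x y, dist x y ≤ L * d x y) (hd' : ∀ x y, d x y ≤ L * dist x y)
    (h : ∀ k, ∃ j, ∀ x y, x ≠ y → dist (ψ x) (ψ y) ∈ C k j (d x y)) :
    (compression ψ, expansion ψ) ∈ M

/-- Description of the coarse moduli. -/
def coarseControl (k : ℕ) (j : ℕ × ℕ) (s : ℝ) : Set ℝ :=
  {t | (s ≤ k + 1 → t ≤ j.1) ∧ ((j.2 : ℝ) + 1 ≤ s → (k : ℝ) ≤ t)}

/-- Description of the uniform moduli. -/
def uniformControl (k : ℕ) (j : ℕ × ℕ) (s : ℝ) : Set ℝ :=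
  {t | (1 / ((k : ℝ) + 1) ≤ s → 1 / ((j.1 : ℝ) + 1) ≤ t) ∧
    (s ≤ 1 / ((j.2 : ℝ) + 1) → t ≤ 1 / ((k : ℝ) + 1))}

/-- Description of the bi-Lipschitz moduli. -/
def lipschitzControl (_k : ℕ) (j : ℕ × ℕ) (s : ℝ) : Set ℝ :=
  {t | s ≤ ((j.1 : ℝ) + 1) * t ∧ t ≤ j.2 * s}

/-- The first parameter bounds `ω` at scale `k + 1`; the second gives a scale from which `κ` exceeds
`k`. -/
theorem isControl_coarse : IsControl coarseModuli coarseControl Y E where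
  isClosed k j s := by
    simp only [coarseControl, Set.ofPred_and, Set.ofPred_forall]
    exact (isClosed_iInter fun _ => isClosed_Iic).inter (isClosed_iInter fun _ => isClosed_Ici)
  exists_param := by
    rintro ⟨κ, ω⟩ ⟨hω, hκ⟩ k
    obtain ⟨a, ha⟩ := ENNReal.exists_nat_gt (hω (natScale k)).ne
    obtain ⟨b, hb⟩ := ((ENNReal.tendsto_nhds_top_iff_nat.1 hκ k)).exists
    refine ⟨(a, b), fun s hs t ht h1 h2 => ⟨fun hsk => ?_, fun hsb => ?_⟩⟩
    · have h3 : scaleAbove s hs ≤ natScale k := scaleAbove_le hs (by rwa [natScale_coe])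
      have h4 := (h2.trans (ω.monotone h3)).trans ha.le
      rw [← ENNReal.ofReal_natCast] at h4
      exact (ENNReal.ofReal_le_ofReal_iff (Nat.cast_nonneg a)).1 h4
    · have h3 : natScale b ≤ scaleBelow s hs := le_scaleBelow hs (by rwa [natScale_coe])
      have h4 := (hb.le.trans (κ.monotone h3)).trans h1
      rw [← ENNReal.ofReal_natCast] at h4
      exact (ENNReal.ofReal_le_ofReal_iff ht).1 h4
  mem_of_forall ψ d L hL hd hd' h := by
    refine ⟨fun r => ?_, ENNReal.tendsto_nhds_top fun n => ?_⟩
    · obtain ⟨k, hk⟩ := exists_nat_ge (L * (r : ℝ))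
      obtain ⟨⟨a, b⟩, hj⟩ := h k
      refine (expansion_le (t := a) fun x y hne hxy => (hj x y hne).1 ?_).trans_lt
        ENNReal.ofReal_lt_top
      have := mul_le_mul_of_nonneg_left hxy hL.le
      linarith [hd' x y]
    -- Index `n + 1` because convergence to `⊤` asks for a strict inequality.
    · obtain ⟨⟨a, b⟩, hj⟩ := h (n + 1)
      obtain ⟨N, hN⟩ := exists_nat_ge (L * ((b : ℝ) + 1))
      filter_upwards [eventually_ge_atTop N] with i hi
      have hn : (n : ℝ≥0∞) < ENNReal.ofReal ((n + 1 : ℕ) : ℝ) := by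
        rw [ENNReal.ofReal_natCast]
        exact Nat.cast_lt.2 n.lt_succ_self
      refine hn.trans_le (le_compression fun x y hne hxy => (hj x y hne).2 ?_)
      rw [natScale_coe] at hxy
      have hi' : (N : ℝ) ≤ i := Nat.cast_le.2 hi
      refine le_of_mul_le_mul_left ?_ hL
      linarith [hd x y]

/-- The first parameter bounds `κ` below at scale `1 / (k + 1)`; the second gives a scale below
which `ω` is at most `1 / (k + 1)`. -/
theorem isControl_uniform : IsControl uniformModuli uniformControl Y E where
  isClosed k j s := by
    simp only [uniformControl, Set.ofPred_and, Set.ofPred_forall]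
    exact (isClosed_iInter fun _ => isClosed_Ici).inter (isClosed_iInter fun _ => isClosed_Iic)
  exists_param := by
    rintro ⟨κ, ω⟩ ⟨hκ, hω⟩ k
    obtain ⟨a, ha⟩ := exists_ofReal_one_div_lt (hκ (invScale k))
    obtain ⟨b, hb⟩ := (ENNReal.tendsto_nhds_zero.1 hω (ENNReal.ofReal (1 / ((k : ℝ) + 1)))
      (ENNReal.ofReal_pos.2 (by positivity))).exists
    refine ⟨(a, b), fun s hs t ht h1 h2 => ⟨fun hsk => ?_, fun hsb => ?_⟩⟩
    · have h3 : invScale k ≤ scaleBelow s hs := le_scaleBelow hs (by rwa [invScale_coe])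
      exact (ENNReal.ofReal_le_ofReal_iff ht).1 ((ha.le.trans (κ.monotone h3)).trans h1)
    · have h3 : scaleAbove s hs ≤ invScale b := scaleAbove_le hs (by rwa [invScale_coe])
      exact (ENNReal.ofReal_le_ofReal_iff (by positivity)).1 ((h2.trans (ω.monotone h3)).trans hb)
  mem_of_forall ψ d L hL hd hd' h := by
    refine ⟨fun r => ?_, ENNReal.tendsto_nhds_zero.2 fun ε hε => ?_⟩
    · obtain ⟨k, hk⟩ := exists_nat_one_div_lt (div_pos r.pos hL)
      obtain ⟨⟨a, b⟩, hj⟩ := h k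
      refine lt_of_lt_of_le (ENNReal.ofReal_pos.2 (by positivity : 0 < 1 / ((a : ℝ) + 1)))
        (le_compression fun x y hne hxy => (hj x y hne).1 (hk.le.trans ?_))
      rw [div_le_iff₀' hL]
      exact hxy.trans (hd x y)
    · obtain ⟨k, hk⟩ := exists_ofReal_one_div_lt hε
      obtain ⟨⟨a, b⟩, hj⟩ := h k
      obtain ⟨N, hN⟩ := exists_nat_ge (L * ((b : ℝ) + 1))
      filter_upwards [eventually_ge_atTop N] with i hi
      refine (expansion_le fun x y hne hxy => (hj x y hne).2 ((hd' x y).trans ?_)).trans hk.le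
      rw [invScale_coe] at hxy
      have hi' : (N : ℝ) ≤ i := Nat.cast_le.2 hi
      refine (mul_le_mul_of_nonneg_left hxy hL.le).trans ?_
      rw [mul_one_div, div_le_div_iff₀ (by positivity) (by positivity)]
      linarith

theorem isControl_lipschitz : IsControl lipschitzModuli lipschitzControl Y E where
  isClosed k j s :=
    (isClosed_le continuous_const (continuous_const.mul continuous_id)).inter isClosed_Iic
  exists_param := by
    rintro ⟨κ, ω⟩ ⟨c, D, hc, hcD, h⟩ _
    -- The factors 2 here and in `D * 2` absorb the rounding of distances to scales.
    obtain ⟨a, ha⟩ := exists_nat_ge (2 / c)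
    obtain ⟨b, hb⟩ := exists_nat_ge (D * 2)
    have hD := hc.trans hcD
    refine ⟨(a, b), fun s hs t ht h1 h2 => ⟨?_, ?_⟩⟩
    · have h3 := (ENNReal.ofReal_le_ofReal_iff ht).1 ((h _).1.trans h1)
      have h4 : 2 ≤ a * c := (div_le_iff₀ hc).1 ha
      have h5 := (scaleBelow s hs).pos
      have h6 : c * s ≤ c * ((a + 1) * t) := by
        have h7 : c * s ≤ 2 * t := by
          linarith [mul_le_mul_of_nonneg_left (le_two_mul_scaleBelow hs) hc.le]
        have h8 : 2 * t ≤ a * c * t := mul_le_mul_of_nonneg_right h4 ht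
        nlinarith [mul_nonneg hc.le ht]
      exact le_of_mul_le_mul_left h6 hc
    · have h3 := (ENNReal.ofReal_le_ofReal_iff
        (mul_nonneg hD.le (scaleAbove s hs).pos.le)).1 (h2.trans (h _).2)
      calc t ≤ D * scaleAbove s hs := h3
        _ ≤ D * (2 * s) := mul_le_mul_of_nonneg_left (scaleAbove_le_two_mul hs) hD.le
        _ = D * 2 * s := by ring
        _ ≤ b * s := mul_le_mul_of_nonneg_right hb hs.le
  mem_of_forall ψ d L hL hd hd' h := by
    obtain ⟨⟨a, b⟩, hj⟩ := h 0
    have hc : 0 < 1 / (L * ((a : ℝ) + 1)) := by positivity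
    -- The terms beyond `b * L` serve only to make the upper constant exceed the lower one.
    refine ⟨1 / (L * ((a : ℝ) + 1)), b * L + 1 / (L * ((a : ℝ) + 1)) + 1, hc, ?_, fun r => ?_⟩
    · have : 0 ≤ (b : ℝ) * L := by positivity
      linarith
    have hr := r.pos
    refine ⟨le_compression fun x y hne hxy => ?_, expansion_le fun x y hne hxy => ?_⟩
    · rw [one_div_mul_eq_div, div_le_iff₀ (by positivity)]
      calc (r : ℝ) ≤ L * d x y := hxy.trans (hd x y)
        _ ≤ L * (((a : ℝ) + 1) * dist (ψ x) (ψ y)) :=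
          mul_le_mul_of_nonneg_left (hj x y hne).1 hL.le
        _ = _ := by ring
    · calc dist (ψ x) (ψ y) ≤ b * d x y := (hj x y hne).2
        _ ≤ b * (L * dist x y) := mul_le_mul_of_nonneg_left (hd' x y) (Nat.cast_nonneg b)
        _ ≤ b * (L * r) := by gcongr
        _ ≤ (b * L + 1 / (L * ((a : ℝ) + 1)) + 1) * r := by nlinarith [mul_pos hc hr]

end Controls

/-! ### Countable codes for quadruples. -/

/-- The points of a separable metric space can be coded by sequences of natural numbers in such a
way that points with the same `k`-th code are `1 / (k + 1)`-close. -/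
theorem exists_coding (E : Type*) [MetricSpace E] [TopologicalSpace.SeparableSpace E] :
    ∃ c : E → ℕ → ℕ, ∀ k v w, c v k = c w k → dist v w < 1 / ((k : ℝ) + 1) := by
  rcases isEmpty_or_nonempty E with hE | hE
  · exact ⟨fun v => hE.elim v, fun k v => hE.elim v⟩
  have h : ∀ (v : E) (k : ℕ), ∃ n, dist v (TopologicalSpace.denseSeq E n) < 1 / ((k : ℝ) + 1) / 2 :=
    fun v k => (TopologicalSpace.denseRange_denseSeq E).exists_dist_lt v (by positivity)
  choose c hc using h
  refine ⟨c, fun k v w hvw => ?_⟩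
  have h1 := hc v k
  have h2 := hc w k
  rw [hvw] at h1
  linarith [dist_triangle_right v w (TopologicalSpace.denseSeq E (c w k))]

/-- Here `m n` is the element added at stage `n`. The cardinality bound guarantees that codes
truncated at the cardinality eventually reveal every entry. -/
theorem exists_strictMono_of_endExt {A : ℕ → Finset ℕ} (hA : ∀ n, EndExt (A (n + 1)) (A n)) :
    ∃ m : ℕ → ℕ, StrictMono m ∧ (∀ k n, k < n → m k ∈ A n) ∧ Monotone A ∧
      ∀ n, n ≤ (A n).card := by
  choose m hm hAm using hA
  have hmem : ∀ n, m n ∈ A (n + 1) := fun n => by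
    rw [hAm]
    exact Finset.mem_insert_self _ _
  have hmono : Monotone A := monotone_nat_of_le_succ fun n => by
    rw [hAm]
    exact Finset.subset_insert _ _
  refine ⟨m, strictMono_nat_of_lt_succ fun n => hm _ _ (hmem n),
    fun k n hkn => hmono hkn (hmem k), hmono, fun n => ?_⟩
  induction n with
  | zero => exact Nat.zero_le _
  | succ n ih =>
    rw [hAm, Finset.card_insert_of_notMem fun h => (hm n _ h).false]
    exact Nat.succ_le_succ ih

section Code

variable {X : Type*} [NormedAddCommGroup X] [NormedSpace ℝ X]
  {R : Subring ℝ} {e : ℕ → X} {E : Type*}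

open Classical in
/-- The part of the codes `c (φ (u i))` of the values of `φ` on `R[A]` that can be read off in
`n` steps, as a finite graph. -/
noncomputable def valueCode (c : E → ℕ → ℕ) (u : ℕ → FullSpan R e) (n : ℕ) (A : Finset ℕ)
    (φ : FullSpan R e → E) : Finset (ℕ × ℕ × ℕ) :=
  ((Finset.range n ×ˢ Finset.range n).filter fun p => (u p.1 : X) ∈ spanOn R e A).image
    fun p => (p.1, p.2, c (φ (u p.1)) p.2)

theorem mem_valueCode {c : E → ℕ → ℕ} {u : ℕ → FullSpan R e} {n : ℕ} {A : Finset ℕ}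
    {φ : FullSpan R e → E} {i k v : ℕ} :
    (i, k, v) ∈ valueCode c u n A φ ↔
      i < n ∧ k < n ∧ (u i : X) ∈ spanOn R e A ∧ c (φ (u i)) k = v := by
  simp only [valueCode, Finset.mem_image, Finset.mem_filter, Finset.mem_product, Finset.mem_range,
    Prod.mk.injEq, Prod.exists]
  constructor
  · rintro ⟨i', k', ⟨⟨hi, hk⟩, hA⟩, rfl, rfl, rfl⟩
    exact ⟨hi, hk, hA, rfl⟩
  · rintro ⟨hi, hk, hA, rfl⟩
    exact ⟨i, k, ⟨⟨hi, hk⟩, hA⟩, rfl, rfl, rfl⟩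

/-- The first `n` values of a sequence, as a finite graph. -/
def paramCode (α : ℕ → ℕ × ℕ) (n : ℕ) : Finset (ℕ × ℕ × ℕ) :=
  (Finset.range n).image fun k => (k, α k)

theorem mem_paramCode {α : ℕ → ℕ × ℕ} {n k : ℕ} {j : ℕ × ℕ} :
    (k, j) ∈ paramCode α n ↔ k < n ∧ α k = j := by
  simp only [paramCode, Finset.mem_image, Finset.mem_range, Prod.mk.injEq]
  constructor
  · rintro ⟨k', hk, rfl, h⟩
    exact ⟨hk, h⟩
  · rintro ⟨hk, h⟩
    exact ⟨k, hk, rfl, h⟩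

/-- The codes of quadruples. -/
abbrev Code : Type := Finset ℕ × Finset (ℕ × ℕ × ℕ) × Finset (ℕ × ℕ × ℕ)

/-- The code of a quadruple: the index set, and finite parts of the parameters of the moduli and
of the values of the map. -/
noncomputable def quadCode (α : Modulus × Modulus → ℕ → ℕ × ℕ) (c : E → ℕ → ℕ) (u : ℕ → FullSpan R e)
    (q : Quad R e E) : Code :=
  (q.2.2.1, paramCode (α (q.1, q.2.1)) q.2.2.1.card,
    valueCode c u q.2.2.1.card q.2.2.1 q.2.2.2)

/-- End extension of codes. -/
def CodeLT (a b : Code) : Prop := EndExt a.1 b.1 ∧ b.2.1 ⊆ a.2.1 ∧ b.2.2 ⊆ a.2.2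

/-- Descent keeps the moduli, hence their parameters, and keeps `φ` on the smaller span, so the
recorded graphs can only grow. -/
theorem codeLT_quadCode (α : Modulus × Modulus → ℕ → ℕ × ℕ) (c : E → ℕ → ℕ)
    (u : ℕ → FullSpan R e) {q q' : Quad R e E} (h : QuadLT R e E q q') :
    CodeLT (quadCode α c u q) (quadCode α c u q') := by
  obtain ⟨⟨h1, h2⟩, hA, hφ⟩ := h
  have hsub : q'.2.2.1 ⊆ q.2.2.1 := by
    obtain ⟨n, -, hn⟩ := hA
    rw [hn]
    exact Finset.subset_insert _ _
  have hcard := Finset.card_le_card hsub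
  refine ⟨hA, ?_, ?_⟩
  · rintro ⟨k, j⟩ hk
    obtain ⟨hk, hj⟩ := mem_paramCode.1 hk
    refine mem_paramCode.2 ⟨hk.trans_le hcard, ?_⟩
    rw [h1, h2]
    exact hj
  · rintro ⟨i, k, v⟩ hi
    obtain ⟨hi, hk, hu, hv⟩ := mem_valueCode.1 hi
    refine mem_valueCode.2 ⟨hi.trans_le hcard, hk.trans_le hcard,
      Submodule.span_mono (Set.image_mono (Finset.coe_subset.2 hsub)) hu, ?_⟩
    rw [hφ _ hu]
    exact hv

end Code

/-! ### From a descending chain of codes to an embedding. -/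

section Dichotomy

variable {X : Type*} [NormedAddCommGroup X] [NormedSpace ℝ X] [CompleteSpace X]
  {E : Type*} [MetricSpace E] [CompleteSpace E]

/-- An infinite descending chain of codes yields an embedding of the full span. -/
theorem embedsInto_of_codeLT_chain {e : SchauderBasis ℝ X} (he : IsSubsymmetric (fun n => e n))
    {R : Subring ℝ} {M : Set (Modulus × Modulus)} {C : ℕ → ℕ × ℕ → ℝ → Set ℝ}
    (hC : IsControl M C (FullSpan R e) E) {α : Modulus × Modulus → ℕ → ℕ × ℕ}
    (hα : ∀ p ∈ M, ∀ (k : ℕ) (s : ℝ) (hs : 0 < s) (t : ℝ), 0 ≤ t →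
      p.1 (scaleBelow s hs) ≤ ENNReal.ofReal t → ENNReal.ofReal t ≤ p.2 (scaleAbove s hs) →
        t ∈ C k (α p k) s)
    {c : E → ℕ → ℕ} (hc : ∀ k v w, c v k = c w k → dist v w < 1 / ((k : ℝ) + 1))
    {u : ℕ → FullSpan R e} (hu : Function.Surjective u) {q : ℕ → Quad R e E}
    (hq : ∀ n, q n ∈ ThetaIn M R e E)
    (hlt : ∀ n, CodeLT (quadCode α c u (q (n + 1))) (quadCode α c u (q n))) :
    EmbedsInto M (FullSpan R e) E := by
  obtain ⟨m, hm, hmA, hA, hcard⟩ :=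
    exists_strictMono_of_endExt (A := fun n => (q n).2.2.1) fun n => (hlt n).1
  have hparam : Monotone fun n => (quadCode α c u (q n)).2.1 :=
    monotone_nat_of_le_succ fun n => (hlt n).2.1
  have hvalue : Monotone fun n => (quadCode α c u (q n)).2.2 :=
    monotone_nat_of_le_succ fun n => (hlt n).2.2
  obtain ⟨T, hT, L, hL⟩ := exists_shift e he hm
  -- An element of the span involves finitely many basis vectors, whose shifts all lie in `A` from
  -- some stage on.
  have hTmem : ∀ x ∈ spanOn R e Set.univ, ∃ N, ∀ n, N ≤ n → T x ∈ spanOn R e (q n).2.2.1 := by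
    intro x hx
    induction hx using Submodule.span_induction with
    | mem x hx =>
      obtain ⟨k, -, rfl⟩ := hx
      refine ⟨k + 1, fun n hn => ?_⟩
      rw [hT]
      exact Submodule.subset_span ⟨m k, hmA k n hn, rfl⟩
    | zero => exact ⟨0, fun n _ => by simp⟩
    | add x y _ _ hx hy =>
      obtain ⟨N, hN⟩ := hx
      obtain ⟨N', hN'⟩ := hy
      refine ⟨max N N', fun n hn => ?_⟩
      rw [map_add]
      exact Submodule.add_mem _ (hN n (le_of_max_le_left hn)) (hN' n (le_of_max_le_right hn))
    | smul a x _ hx =>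
      obtain ⟨N, hN⟩ := hx
      refine ⟨N, fun n hn => ?_⟩
      have : T (a • x) = a • T x := T.map_smul (a : ℝ) x
      rw [this]
      exact Submodule.smul_mem _ _ (hN n hn)
  choose N hN using fun x : FullSpan R e => hTmem x x.2
  let τ : FullSpan R e → FullSpan R e := fun x =>
    ⟨T x, Submodule.span_mono (Set.image_mono (Set.subset_univ _)) (hN x _ le_rfl)⟩
  have hτdist : ∀ x y, dist (τ x) (τ y) = ‖T ((x : X) - y)‖ := by
    intro x y
    rw [map_sub]
    exact dist_eq_norm (T x) (T y)
  have hdist : ∀ x y : FullSpan R e, dist x y = ‖(x : X) - y‖ := fun x y => dist_eq_norm (x : X) y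
  have hstable : ∀ x k, ∃ n₀, ∀ n, n₀ ≤ n →
      c ((q n).2.2.2 (τ x)) k = c ((q n₀).2.2.2 (τ x)) k := by
    intro x k
    obtain ⟨i, hi⟩ := hu (τ x)
    -- From this stage on `τ x = u i` lies in the span and the truncation passes both `i` and `k`,
    -- so the code of the value is recorded and inherited.
    refine ⟨max (N x) (max (i + 1) (k + 1)), fun n hn => ?_⟩
    set n₀ := max (N x) (max (i + 1) (k + 1)) with hn₀
    have h1 : (i, k, c ((q n₀).2.2.2 (u i)) k) ∈ (quadCode α c u (q n₀)).2.2 := by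
      refine mem_valueCode.2 ⟨?_, ?_, ?_, rfl⟩
      · exact lt_of_lt_of_le (by omega) (hcard n₀)
      · exact lt_of_lt_of_le (by omega) (hcard n₀)
      · rw [hi]
        exact hN x n₀ (le_max_left _ _)
    have h2 := (mem_valueCode.1 (hvalue hn h1)).2.2.2
    rwa [hi] at h2
  have hlim : ∀ x, ∃ z, Tendsto (fun n => (q n).2.2.2 (τ x)) atTop (𝓝 z) := by
    intro x
    refine cauchySeq_tendsto_of_complete (Metric.cauchySeq_iff'.2 fun ε hε => ?_)
    obtain ⟨k, hk⟩ := exists_nat_one_div_lt hε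
    obtain ⟨n₀, h⟩ := hstable x k
    exact ⟨n₀, fun n hn => (hc k _ _ (h n hn)).trans hk⟩
  choose ψ hψ using hlim
  -- One positive constant serves both estimates comparing `x` with `τ x`.
  have hpos : 0 < |L| + ‖T‖ + 1 := by positivity
  have hd : ∀ x y, dist x y ≤ (|L| + ‖T‖ + 1) * dist (τ x) (τ y) := by
    intro x y
    rw [hτdist, hdist]
    refine (hL _).trans (mul_le_mul_of_nonneg_right ?_ (norm_nonneg _))
    linarith [le_abs_self L, norm_nonneg T]
  refine ⟨ψ, hC.mem_of_forall ψ (fun x y => dist (τ x) (τ y)) (|L| + ‖T‖ + 1) hpos hd ?_ ?_⟩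
  · intro x y
    rw [hτdist, hdist]
    refine (T.le_opNorm _).trans (mul_le_mul_of_nonneg_right ?_ (norm_nonneg _))
    linarith [abs_nonneg L]
  · intro k
    have hαk : ∀ n, k + 1 ≤ n →
        α ((q n).1, (q n).2.1) k = α ((q (k + 1)).1, (q (k + 1)).2.1) k := by
      intro n hn
      have h1 : (k, α ((q (k + 1)).1, (q (k + 1)).2.1) k) ∈ (quadCode α c u (q (k + 1))).2.1 :=
        mem_paramCode.2 ⟨hcard (k + 1), rfl⟩
      exact (mem_paramCode.1 (hparam hn h1)).2
    refine ⟨α ((q (k + 1)).1, (q (k + 1)).2.1) k, fun x y hne => ?_⟩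
    -- The inequalities defining `Theta` concern distinct points only.
    have hne' : τ x ≠ τ y := by
      intro h
      have := hd x y
      rw [h, dist_self, mul_zero] at this
      exact hne (dist_le_zero.1 this)
    refine (hC.isClosed _ _ _).mem_of_tendsto ((hψ x).dist (hψ y)) ?_
    filter_upwards [eventually_ge_atTop (k + 1), eventually_ge_atTop (N x),
      eventually_ge_atTop (N y)] with n hnk hnx hny
    have h := (hq n).1 (τ x) (τ y) (hN x n hnx) (hN y n hny) hne'
    rw [edist_dist] at h
    rw [← hαk n hnk]
    exact hα _ (hq n).2 k _ (dist_pos.2 hne') _ dist_nonneg h.1 h.2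

theorem embedsInto_or_hasCountableRank [TopologicalSpace.SeparableSpace E]
    {e : SchauderBasis ℝ X} (he : IsSubsymmetric (fun n => e n)) {R : Subring ℝ} [Countable R]
    {M : Set (Modulus × Modulus)} {C : ℕ → ℕ × ℕ → ℝ → Set ℝ}
    (hC : IsControl M C (FullSpan R e) E) :
    EmbedsInto M (FullSpan R e) E ∨ HasCountableRank (ltOn R e E (ThetaIn M R e E)) := by
  classical
  obtain ⟨c, hc⟩ := exists_coding E
  have : Countable (FullSpan R e) := by
    rw [FullSpan, spanOn, Set.image_univ]
    infer_instance
  obtain ⟨u, hu⟩ := exists_surjective_nat (FullSpan R e)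
  have hex : ∀ p : Modulus × Modulus, ∃ a : ℕ → ℕ × ℕ, p ∈ M → ∀ (k : ℕ) (s : ℝ) (hs : 0 < s)
      (t : ℝ), 0 ≤ t → p.1 (scaleBelow s hs) ≤ ENNReal.ofReal t →
        ENNReal.ofReal t ≤ p.2 (scaleAbove s hs) → t ∈ C k (a k) s := by
    intro p
    by_cases hp : p ∈ M
    · choose a ha using hC.exists_param p hp
      exact ⟨a, fun _ => ha⟩
    · exact ⟨fun _ => 0, fun h => absurd h hp⟩
  choose α hα using hex
  let f : ThetaIn M R e E → Code := fun q => quadCode α c u q.1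
  -- Restricting to codes that occur lets every term of a descending chain be realised by a
  -- quadruple.
  let s : Code → Code → Prop := fun a b => a ∈ Set.range f ∧ b ∈ Set.range f ∧ CodeLT a b
  by_cases hs : WellFounded s
  · right
    -- `ULift` moves the codes into the universe of the quadruples, where the ranks are compared.
    refine hasCountableRank_of_map (s := fun a b : ULift Code => s a.down b.down)
      (InvImage.wf ULift.down hs) (fun q => ULift.up (f q)) fun a b hab => ?_
    exact ⟨⟨a, rfl⟩, ⟨b, rfl⟩, codeLT_quadCode α c u hab⟩
  · left
    rw [wellFounded_iff_isEmpty_descending_chain, not_isEmpty_iff] at hs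
    obtain ⟨g, hg⟩ := hs
    choose q hq using fun n => (hg n).2.1
    refine embedsInto_of_codeLT_chain he hC hα hc hu (q := fun n => (q n).1)
      (fun n => (q n).2) fun n => ?_
    have := (hg n).2.2
    rwa [← hq n, ← hq (n + 1)] at this

end Dichotomy

end EmbRank

theorem mainTheorem5 {X : Type*} [NormedAddCommGroup X] [NormedSpace ℝ X] [CompleteSpace X]
    (e : SchauderBasis ℝ X) (he : IsSubsymmetric (fun n => e n))
    {E : Type*} [MetricSpace E] [TopologicalSpace.SeparableSpace E] [CompleteSpace E]
    (R : Subring ℝ) (hR : R = (Int.castRingHom ℝ).range ∨ R = (Rat.castHom ℝ).range) :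
    (CoarselyEmbeds (FullSpan R e) E ∨ HasCountableRank (ltOn R e E (Coa R e E))) ∧
    (UniformlyEmbeds (FullSpan R e) E ∨ HasCountableRank (ltOn R e E (Uni R e E))) ∧
    (BiLipschitzEmbeds (FullSpan R e) E ∨ HasCountableRank (ltOn R e E (Lip R e E))) := by
  have : Countable R := by
    rcases hR with rfl | rfl
    · exact (Set.countable_range (Int.castRingHom ℝ)).to_subtype
    · exact (Set.countable_range (Rat.castHom ℝ)).to_subtype
  exact ⟨embedsInto_or_hasCountableRank he isControl_coarse,
    embedsInto_or_hasCountableRank he isControl_uniform,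
    embedsInto_or_hasCountableRank he isControl_lipschitz⟩
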